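/- A metric space $(X,d)$ is geodesic if any two points $x,y\in X$ are joined by a curve of length $d(x,y)$. A geodesic metric space $(X,d)$ is an Alexandrov space of nonnegative curvature if, for all $x,y,z\in X$ and every minimal geodesic $\gamma:[0,1]\to X$ from $y$ to $z$ (a locally minimizing curve of constant speed and of length $d(y,z)$), $$d\big(x,\gamma(\tfrac12)\big)^2\ \ge\ \tfrac12 d(x,y)^2+\tfrac12 d(x,z)^2-\tfrac14 d(y,z)^2 .$$ For $N\in\mathbb N=\{1,2,\dots\}$, a stationary reversible chain on $\{1,\dots,N\}$ is a pair $(\pi,A)$, $\pi=(\pi_i)_{i=1}^N$, $A=(a_{ij})_{i,j=1}^N$, with $0\le\pi_i\le1$, $0\le a_{ij}\le1$, $\sum_i\pi_i=1$, $\sum_j a_{ij}=1$ and $\pi_ia_{ij}=\pi_ja_{ji}$ for all $i,j$. Write $A^l=(a^{(l)}_{ij})$. A metric space $(X,d)$ has Markov type $2$ if there is a constant $K\ge1$ such that for all $\alpha\in(0,1)$, $N\in\mathbb N$, $x_1,\dots,x_N\in X$ and all stationary reversible chains $(\pi,A)$ on $\{1,\dots,N\}$, $$(1-\alpha)\sum_{i,j=1}^N\pi_i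 c_{ij}\,d(x_i,x_j)^2\ \le\ K^2\alpha\sum_{i,j=1}^N\pi_i a_{ij}\,d(x_i,x_j)^2,\qquad (c_{ij})=(1-\alpha)(I-\alpha A)^{-1};$$ the infimum of such $K\ge 1$ is denoted by $M_2(X)$. **Theorem 4.2.** Let $(X,d)$ be an Alexandrov space of nonnegative curvature. Then $(X,d)$ has Markov type $2$ with $M_2(X)\le 1+\sqrt2$. More precisely, for all $l,N\in\mathbb N$, all $x_1,\dots,x_N\in X$ and all stationary reversible chains $(\pi,A)$ on $\{1,\dots,N\}$, $$\sum_{i,j=1}^N\pi_i a^{(l)}_{ij}\,d(x_i,x_j)^2\ \le\ (1+\sqrt2)^2\,l\sum_{i,j=1}^N\pi_i a_{ij}\,d(x_i,x_j)^2 .$$ -/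

import Mathlib

open scoped ENNReal

namespace MarkovTypeTwo

section Geodesics

variable {X : Type*} [MetricSpace X]

/-- The length of the restriction to `[0,1]` of `γ`: the supremum of the lengths of the inscribed
polygons. Curves `[0,1] → X` are represented by maps `ℝ → X`, of which only the
values on `[0,1]` matter. -/
noncomputable def curveLength (γ : ℝ → X) : ℝ≥0∞ :=
  eVariationOn γ (Set.Icc 0 1)

/-- Any two points are joined by a (continuous) curve whose length is their distance. -/
def IsGeodesicSpace (X : Type*) [MetricSpace X] : Prop :=
  ∀ x y : X, ∃ γ : ℝ → X, ContinuousOn γ (Set.Icc 0 1) ∧ γ 0 = x ∧ γ 1 = y ∧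
    curveLength γ = edist x y

/-- Every time has a neighbourhood in `[0,1]` such that each subarc of `γ` inside this
neighbourhood realizes the distance between its ends. -/
def IsLocallyMinimizing (γ : ℝ → X) : Prop :=
  ∀ t ∈ Set.Icc (0 : ℝ) 1, ∃ ε > 0, ∀ r ∈ Set.Icc (0 : ℝ) 1, ∀ s ∈ Set.Icc (0 : ℝ) 1,
    |r - t| < ε → |s - t| < ε → r ≤ s →
      eVariationOn γ (Set.Icc r s) = edist (γ r) (γ s)

/-- A geodesic: a rectifiable curve which is locally minimizing and has a constant speed. -/
structure IsGeodesic (γ : ℝ → X) : Prop where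
  continuousOn : ContinuousOn γ (Set.Icc 0 1)
  rectifiable : curveLength γ ≠ ∞
  locallyMinimizing : IsLocallyMinimizing γ
  constantSpeed : ∃ v, HasConstantSpeedOnWith γ (Set.Icc 0 1) v

/-- A minimal geodesic: a geodesic whose length is the distance between its ends. -/
structure IsMinimalGeodesic (γ : ℝ → X) : Prop where
  isGeodesic : IsGeodesic γ
  minimal : curveLength γ = edist (γ 0) (γ 1)

/-- Alexandrov spaces of nonnegative curvature: geodesic metric spaces in which the distance
to the midpoint of a minimal geodesic is at least the one in the Euclidean comparison triangle. -/
structure IsAlexandrovNonneg (X : Type*) [MetricSpace X] : Prop where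
  geodesic : IsGeodesicSpace X
  midpoint_le : ∀ (x y z : X) (γ : ℝ → X), IsMinimalGeodesic γ → γ 0 = y → γ 1 = z →
    dist x (γ (1 / 2)) ^ 2 ≥
      1 / 2 * dist x y ^ 2 + 1 / 2 * dist x z ^ 2 - 1 / 4 * dist y z ^ 2

end Geodesics

/-- `π` is an initial distribution and `A` a transition matrix on `N` states which define
a stationary, reversible Markov chain. -/
structure IsReversibleChain {N : ℕ} (π : Fin N → ℝ) (A : Matrix (Fin N) (Fin N) ℝ) : Prop where
  init_nonneg : ∀ i, 0 ≤ π i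
  init_le_one : ∀ i, π i ≤ 1
  trans_nonneg : ∀ i j, 0 ≤ A i j
  trans_le_one : ∀ i j, A i j ≤ 1
  init_sum : ∑ i, π i = 1
  trans_sum : ∀ i, ∑ j, A i j = 1
  reversible : ∀ i j, π i * A i j = π j * A j i

/-- The matrix `C = (1 - α) (I - α A)⁻¹`. -/
noncomputable def resolventMatrix {N : ℕ} (α : ℝ) (A : Matrix (Fin N) (Fin N) ℝ) :
    Matrix (Fin N) (Fin N) ℝ :=
  (1 - α) • (1 - α • A)⁻¹

/-- The inequality defining Markov type `2`, with the constant `K`. -/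
def MarkovTypeTwoWith (X : Type*) [MetricSpace X] (K : ℝ) : Prop :=
  ∀ α : ℝ, 0 < α → α < 1 → ∀ (N : ℕ) (x : Fin N → X) (π : Fin N → ℝ)
    (A : Matrix (Fin N) (Fin N) ℝ), IsReversibleChain π A →
      (1 - α) * ∑ i, ∑ j, π i * resolventMatrix α A i j * dist (x i) (x j) ^ 2 ≤
        K ^ 2 * α * ∑ i, ∑ j, π i * A i j * dist (x i) (x j) ^ 2

/-- `X` has Markov type `2`. -/
def HasMarkovTypeTwo (X : Type*) [MetricSpace X] : Prop :=
  ∃ K : ℝ, 1 ≤ K ∧ MarkovTypeTwoWith X K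

/-- The Markov type constant `M₂(X)` (meaningful if `X` has Markov type `2`). -/
noncomputable def markovConst (X : Type*) [MetricSpace X] : ℝ :=
  sInf {K : ℝ | 1 ≤ K ∧ MarkovTypeTwoWith X K}

end MarkovTypeTwo

/-! Fix a point `o` and regard points `a`, `b` as vectors from `o`, with the inner product `⟨a, b⟩`
read off the Euclidean comparison triangle. The point `h` halfway from `o` to `a` satisfies
`2 ⟨h, b⟩ ≤ ⟨a, b⟩`, so when all points are moved halfway to `o` repeatedly, the rescaled inner
products decrease to limits. At scales where they are almost constant, two vectors can be replaced
by the comparison point between them with a negligible loss; merging all vectors into one shows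
that `∑ wᵢ wⱼ ⟨xᵢ, xⱼ⟩ ≥ 0` for nonnegative weights, which is the Lang–Schroeder–Sturm inequality
`∑ wᵢ wⱼ d(xᵢ, xⱼ)² ≤ 2 (∑ wᵢ) ∑ wᵢ d(o, xᵢ)²`.

Applied to the rows of `A ^ l`, this yields `E (2 l) ≤ 2 E l` for the mean squared displacement
`E l` of a stationary reversible chain, hence `E (2 ^ n) ≤ 2 ^ n E 1`. The Minkowski inequality
gives `√E (l + m) ≤ √E l + √E m`, and splitting off the largest power of two, `l = 2 ^ n + m`, the
bound `√E l ≤ (1 + √2) √l √E 1` follows by induction from `√a + (1 + √2) √b ≤ (1 + √2) √(a + b)`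
for `b ≤ a`. Averaging over `l` with geometric weights turns powers into the resolvent. -/

namespace MarkovTypeTwo

open Filter Finset Topology

section AffineGeodesics

variable {X : Type*} [PseudoMetricSpace X] {γ : ℝ → X}

/-- A curve on `[0,1]` along which distances are proportional to differences of parameters, that
is, a minimal geodesic of constant speed described by distances instead of lengths. -/
def IsAffineGeodesic (γ : ℝ → X) : Prop :=
  ∀ s ∈ Set.Icc (0 : ℝ) 1, ∀ t ∈ Set.Icc (0 : ℝ) 1,
    dist (γ s) (γ t) = |s - t| * dist (γ 0) (γ 1)

namespace IsAffineGeodesic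

theorem lipschitzOnWith (h : IsAffineGeodesic γ) :
    LipschitzOnWith (nndist (γ 0) (γ 1)) γ (Set.Icc 0 1) :=
  LipschitzOnWith.of_dist_le_mul fun s hs t ht => by
    rw [h s hs t ht, Real.dist_eq, coe_nndist, mul_comm]

theorem comp_lineMap (h : IsAffineGeodesic γ) {r s : ℝ} (hr : r ∈ Set.Icc (0 : ℝ) 1)
    (hs : s ∈ Set.Icc (0 : ℝ) 1) : IsAffineGeodesic (γ ∘ AffineMap.lineMap r s) := by
  intro a ha b hb
  have hmem : ∀ {c : ℝ}, c ∈ Set.Icc (0 : ℝ) 1 → AffineMap.lineMap r s c ∈ Set.Icc (0 : ℝ) 1 :=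
    fun hc => (convex_Icc 0 1).lineMap_mem hr hs hc
  simp only [Function.comp_apply, AffineMap.lineMap_apply_zero, AffineMap.lineMap_apply_one]
  rw [h _ (hmem ha) _ (hmem hb), h r hr s hs, ← Real.dist_eq, dist_lineMap_lineMap, Real.dist_eq,
    Real.dist_eq, mul_assoc]

theorem edist_eq_ofReal (h : IsAffineGeodesic γ) {r s : ℝ} (hr : r ∈ Set.Icc (0 : ℝ) 1)
    (hs : s ∈ Set.Icc (0 : ℝ) 1) (hrs : r ≤ s) :
    edist (γ r) (γ s) = ENNReal.ofReal (nndist (γ 0) (γ 1) * (s - r)) := by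
  rw [edist_dist, h r hr s hs, abs_sub_comm, abs_of_nonneg (sub_nonneg.2 hrs), coe_nndist,
    mul_comm]

theorem eVariationOn_Icc (h : IsAffineGeodesic γ) {r s : ℝ} (hr : r ∈ Set.Icc (0 : ℝ) 1)
    (hs : s ∈ Set.Icc (0 : ℝ) 1) (hrs : r ≤ s) :
    eVariationOn γ (Set.Icc r s) = edist (γ r) (γ s) := by
  have hr' := Set.left_mem_Icc.2 hrs
  have hs' := Set.right_mem_Icc.2 hrs
  refine le_antisymm ?_ (eVariationOn.edist_le γ hr' hs')
  have hid : eVariationOn id (Set.Icc r s) = ENNReal.ofReal (s - r) := by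
    simpa only [Set.inter_self, id] using monotoneOn_id.eVariationOn_eq hr' hs'
  calc eVariationOn γ (Set.Icc r s)
      ≤ nndist (γ 0) (γ 1) * eVariationOn id (Set.Icc r s) :=
        (h.lipschitzOnWith.mono (Set.Icc_subset_Icc hr.1 hs.2)).comp_eVariationOn_le
          (Set.mapsTo_id _)
    _ = edist (γ r) (γ s) := by
        rw [hid, h.edist_eq_ofReal hr hs hrs, ENNReal.ofReal_mul NNReal.zero_le_coe,
          ENNReal.ofReal_coe_nnreal]

end IsAffineGeodesic

theorem IsAffineGeodesic.isMinimalGeodesic {X : Type*} [MetricSpace X] {γ : ℝ → X}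
    (h : IsAffineGeodesic γ) : IsMinimalGeodesic γ := by
  have hlen : curveLength γ = edist (γ 0) (γ 1) :=
    h.eVariationOn_Icc (by simp) (by simp) zero_le_one
  refine ⟨⟨h.lipschitzOnWith.continuousOn, hlen ▸ edist_ne_top _ _,
    fun t _ => ⟨1, one_pos, fun r hr s hs _ _ hrs => h.eVariationOn_Icc hr hs hrs⟩,
    nndist (γ 0) (γ 1), ?_⟩, hlen⟩
  rw [hasConstantSpeedOnWith_iff_ordered]
  intro r hr s hs hrs
  rw [Set.inter_eq_right.2 (Set.Icc_subset_Icc hr.1 hs.2), h.eVariationOn_Icc hr hs hrs,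
    h.edist_eq_ofReal hr hs hrs]

end AffineGeodesics

section GeodesicSpaces

variable {X : Type*} [MetricSpace X]

theorem dist_add_dist_eq_of_curveLength_eq {γ : ℝ → X} (h : curveLength γ = edist (γ 0) (γ 1))
    {s t : ℝ} (h0 : 0 ≤ s) (hst : s ≤ t) (h1 : t ≤ 1) :
    dist (γ 0) (γ s) + dist (γ s) (γ t) = dist (γ 0) (γ t) := by
  refine le_antisymm ?_ (dist_triangle _ _ _)
  have hsplit : eVariationOn γ (Set.Icc 0 s) + eVariationOn γ (Set.Icc s t) +
      eVariationOn γ (Set.Icc t 1) = curveLength γ := by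
    have h0t := eVariationOn.Icc_add_Icc γ h0 hst (Set.mem_univ s)
    have h01 := eVariationOn.Icc_add_Icc γ (h0.trans hst) h1 (Set.mem_univ t)
    simp only [Set.univ_inter] at h0t h01
    rw [h0t, h01, curveLength]
  have hle : edist (γ 0) (γ s) + edist (γ s) (γ t) + edist (γ t) (γ 1) ≤
      edist (γ 0) (γ t) + edist (γ t) (γ 1) := by
    refine le_trans ?_ (edist_triangle _ _ _)
    rw [← h, ← hsplit]
    gcongr <;> apply eVariationOn.edist_le <;> simp [*]
  have hle' := (ENNReal.add_le_add_iff_right (edist_ne_top _ _)).1 hle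
  simpa only [edist_nndist, ← ENNReal.coe_add, ENNReal.coe_le_coe, ← NNReal.coe_le_coe,
    NNReal.coe_add, coe_nndist] using hle'

theorem dist_eq_abs_sub_of_curveLength_eq {γ : ℝ → X} (h : curveLength γ = edist (γ 0) (γ 1))
    {s t : ℝ} (hs : s ∈ Set.Icc (0 : ℝ) 1) (ht : t ∈ Set.Icc (0 : ℝ) 1) :
    dist (γ s) (γ t) = |dist (γ 0) (γ s) - dist (γ 0) (γ t)| := by
  wlog hst : s ≤ t generalizing s t
  · rw [dist_comm, abs_sub_comm, this ht hs (le_of_not_ge hst)]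
  rw [← dist_add_dist_eq_of_curveLength_eq h hs.1 hst ht.2, sub_add_cancel_left, abs_neg,
    abs_of_nonneg dist_nonneg]

theorem IsGeodesicSpace.exists_isAffineGeodesic (hX : IsGeodesicSpace X) (y z : X) :
    ∃ γ : ℝ → X, γ 0 = y ∧ γ 1 = z ∧ IsAffineGeodesic γ := by
  obtain ⟨c, hc, rfl, rfl, hlen⟩ := hX y z
  have hcont : ContinuousOn (fun t => dist (c 0) (c t)) (Set.Icc 0 1) := by fun_prop
  have harc : ∀ s ∈ Set.Icc (0 : ℝ) 1, ∃ t ∈ Set.Icc (0 : ℝ) 1,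
      dist (c 0) (c t) = s * dist (c 0) (c 1) := fun s hs =>
    intermediate_value_Icc zero_le_one hcont
      ⟨by simpa using mul_nonneg hs.1 dist_nonneg,
        by simpa using mul_le_mul_of_nonneg_right hs.2 dist_nonneg⟩
  choose! τ hτ hτdist using harc
  have h0 : c (τ 0) = c 0 := by
    rw [← dist_eq_zero, dist_comm, hτdist 0 (by simp), zero_mul]
  have h1 : c (τ 1) = c 1 := by
    rw [← dist_eq_zero, dist_eq_abs_sub_of_curveLength_eq hlen (hτ 1 (by simp)) (by simp),
      hτdist 1 (by simp), one_mul, sub_self, abs_zero]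
  refine ⟨c ∘ τ, h0, h1, fun s hs t ht => ?_⟩
  simp only [Function.comp_apply, h0, h1]
  rw [dist_eq_abs_sub_of_curveLength_eq hlen (hτ s hs) (hτ t ht), hτdist s hs, hτdist t ht,
    ← sub_mul, abs_mul, abs_of_nonneg dist_nonneg]

end GeodesicSpaces

section ComparisonPoints

/-- `m` is at parameter `s` on the way from `a` to `b`, and its distances to all points are at
least those in the Euclidean comparison triangles. -/
structure IsComparisonPoint {X : Type*} [PseudoMetricSpace X] (s : ℝ) (a b m : X) : Prop where
  dist_left : dist a m = s * dist a b
  le_dist_sq : ∀ x, (1 - s) * dist x a ^ 2 + s * dist x b ^ 2 - s * (1 - s) * dist a b ^ 2 ≤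
    dist x m ^ 2

/-- Nonnegative curvature in the form of Stewart's inequality: any two points have comparison
points at all parameters in `[0,1]`. -/
def HasComparisonPoints (X : Type*) [PseudoMetricSpace X] : Prop :=
  ∀ a b : X, ∀ s ∈ Set.Icc (0 : ℝ) 1, ∃ m, IsComparisonPoint s a b m

theorem nonneg_of_le_midpoint {a b : ℝ} {φ : ℝ → ℝ} (hφ : ContinuousOn φ (Set.Icc a b))
    (ha : 0 ≤ φ a) (hb : 0 ≤ φ b)
    (hmid : ∀ r ∈ Set.Icc a b, ∀ s ∈ Set.Icc a b, (φ r + φ s) / 2 ≤ φ ((r + s) / 2))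
    {t : ℝ} (ht : t ∈ Set.Icc a b) : 0 ≤ φ t := by
  obtain ⟨t₀, ht₀, hmin⟩ := isCompact_Icc.exists_isMinOn ⟨t, ht⟩ hφ
  have hab : a ≤ b := ht.1.trans ht.2
  suffices h : 0 ≤ φ t₀ from h.trans (hmin ht)
  -- The minimum point is the midpoint of an end of the interval and another of its points.
  rcases le_total t₀ ((a + b) / 2) with h | h
  · have hs : 2 * t₀ - a ∈ Set.Icc a b := ⟨by linarith [ht₀.1], by linarith⟩
    have hle := hmid a (Set.left_mem_Icc.2 hab) _ hs
    rw [show (a + (2 * t₀ - a)) / 2 = t₀ by ring] at hle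
    linarith [isMinOn_iff.1 hmin _ hs]
  · have hs : 2 * t₀ - b ∈ Set.Icc a b := ⟨by linarith, by linarith [ht₀.2]⟩
    have hle := hmid _ hs b (Set.right_mem_Icc.2 hab)
    rw [show (2 * t₀ - b + b) / 2 = t₀ by ring] at hle
    linarith [isMinOn_iff.1 hmin _ hs]

variable {X : Type*} [MetricSpace X]

theorem IsAlexandrovNonneg.le_dist_sq_midpoint (hX : IsAlexandrovNonneg X) {γ : ℝ → X}
    (hγ : IsAffineGeodesic γ) (x : X) {r s : ℝ} (hr : r ∈ Set.Icc (0 : ℝ) 1)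
    (hs : s ∈ Set.Icc (0 : ℝ) 1) :
    dist x (γ r) ^ 2 / 2 + dist x (γ s) ^ 2 / 2 - (r - s) ^ 2 * dist (γ 0) (γ 1) ^ 2 / 4 ≤
      dist x (γ ((r + s) / 2)) ^ 2 := by
  have h := hX.midpoint_le x (γ r) (γ s) _ (hγ.comp_lineMap hr hs).isMinimalGeodesic
    (by simp) (by simp)
  have hmid : AffineMap.lineMap r s (1 / 2 : ℝ) = (r + s) / 2 := by
    rw [AffineMap.lineMap_apply_ring']
    ring
  rw [Function.comp_apply, hmid, hγ r hr s hs, mul_pow, sq_abs] at h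
  linarith

theorem IsAlexandrovNonneg.isComparisonPoint (hX : IsAlexandrovNonneg X) {γ : ℝ → X}
    (hγ : IsAffineGeodesic γ) {t : ℝ} (ht : t ∈ Set.Icc (0 : ℝ) 1) :
    IsComparisonPoint t (γ 0) (γ 1) (γ t) where
  dist_left := by rw [hγ 0 (by simp) t ht, zero_sub, abs_neg, abs_of_nonneg ht.1]
  le_dist_sq x := by
    have hcont : ContinuousOn γ (Set.Icc 0 1) := hγ.lipschitzOnWith.continuousOn
    rw [← sub_nonneg]
    refine nonneg_of_le_midpoint (a := 0) (b := 1) (φ := fun t => dist x (γ t) ^ 2 -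
      ((1 - t) * dist x (γ 0) ^ 2 + t * dist x (γ 1) ^ 2 - t * (1 - t) * dist (γ 0) (γ 1) ^ 2))
      (by fun_prop) (by simp) (by simp) (fun r hr s hs => ?_) ht
    linarith [hX.le_dist_sq_midpoint hγ x hr hs]

theorem IsAlexandrovNonneg.hasComparisonPoints (hX : IsAlexandrovNonneg X) :
    HasComparisonPoints X := by
  intro a b s hs
  obtain ⟨γ, rfl, rfl, hγ⟩ := hX.geodesic.exists_isAffineGeodesic a b
  exact ⟨γ s, hX.isComparisonPoint hγ hs⟩

end ComparisonPoints

section ComparisonInner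

variable {X : Type*} [PseudoMetricSpace X] {o a a₀ b m : X} {s : ℝ}

/-- The inner product of `a` and `b`, seen as vectors from `o`, in the Euclidean comparison
triangle of `o`, `a`, `b`. -/
noncomputable def comparisonInner (o a b : X) : ℝ :=
  (dist o a ^ 2 + dist o b ^ 2 - dist a b ^ 2) / 2

theorem comparisonInner_comm (o a b : X) : comparisonInner o a b = comparisonInner o b a := by
  rw [comparisonInner, comparisonInner, dist_comm a b, add_comm (dist o a ^ 2)]

theorem comparisonInner_self (o a : X) : comparisonInner o a a = dist o a ^ 2 := by
  simp [comparisonInner]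

theorem neg_dist_mul_dist_le_comparisonInner (o a b : X) :
    -(dist o a * dist o b) ≤ comparisonInner o a b := by
  have h := pow_le_pow_left₀ dist_nonneg (dist_triangle_left a b o) 2
  rw [comparisonInner]
  linarith

theorem IsComparisonPoint.comparisonInner_le_mul (h : IsComparisonPoint s o a b) (x : X) :
    comparisonInner o b x ≤ s * comparisonInner o a x := by
  have hx := h.le_dist_sq x
  simp only [comparisonInner, h.dist_left]
  rw [dist_comm x b, dist_comm x a, dist_comm x o] at hx
  linarith

/-- The excess of the squared distance from `o` to `m` over the squared norm of the vector
`(1 - s) a + s b`, expanded with `comparisonInner o`. -/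
noncomputable def normSqExcess (o : X) (s : ℝ) (a b m : X) : ℝ :=
  dist o m ^ 2 - ((1 - s) ^ 2 * dist o a ^ 2 + 2 * s * (1 - s) * comparisonInner o a b +
    s ^ 2 * dist o b ^ 2)

theorem IsComparisonPoint.comparisonInner_le (h : IsComparisonPoint s a b m) (o x : X) :
    comparisonInner o m x ≤ (1 - s) * comparisonInner o a x + s * comparisonInner o b x +
      normSqExcess o s a b m / 2 := by
  have hx := h.le_dist_sq x
  simp only [normSqExcess, comparisonInner]
  rw [dist_comm x a, dist_comm x b, dist_comm x m] at hx
  linarith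

-- Being far from `a₀` and at a known distance from the midpoint `a`, the point `m` cannot be far
-- from `o`.
theorem IsComparisonPoint.normSqExcess_le (hm : IsComparisonPoint s a b m) (hs : s ≤ 1)
    (ha : IsComparisonPoint (1 / 2) o a₀ a) :
    normSqExcess o s a b m ≤ 2 * s * (comparisonInner o a₀ b - 2 * comparisonInner o a b) := by
  have hma : comparisonInner o a m ≤ 1 / 2 * comparisonInner o m a₀ := by
    simpa only [comparisonInner_comm o m] using ha.comparisonInner_le_mul m
  have hma₀ := hm.comparisonInner_le o a₀
  have haa₀ : comparisonInner o a a₀ ≤ 2 * dist o a ^ 2 := by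
    have h := ha.comparisonInner_le_mul a₀
    rw [comparisonInner_self] at h
    rw [ha.dist_left]
    linarith
  have hdist : dist a m ^ 2 = s ^ 2 * dist a b ^ 2 := by rw [hm.dist_left, mul_pow]
  rw [comparisonInner_comm o a₀]
  have hmul := mul_le_mul_of_nonneg_left haa₀ (sub_nonneg.2 hs)
  have hinner : 2 * comparisonInner o a m =
      2 * (1 - s) * dist o a ^ 2 + 2 * s * comparisonInner o a b + normSqExcess o s a b m := by
    simp only [normSqExcess, comparisonInner, hdist]
    ring
  linarith

end ComparisonInner

section HalvingSequences

variable {X : Type*} [PseudoMetricSpace X] {o : X} {a b : ℕ → X}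

/-- A sequence of points approaching `o`, each of which is a comparison midpoint of `o` and the
preceding one; it discretizes a geodesic from `a 0` to `o`. -/
def IsHalvingSequence (o : X) (a : ℕ → X) : Prop :=
  ∀ n, IsComparisonPoint (1 / 2) o (a n) (a (n + 1))

theorem HasComparisonPoints.exists_isHalvingSequence (hX : HasComparisonPoints X) (o p : X) :
    ∃ a, a 0 = p ∧ IsHalvingSequence o a := by
  choose mid hmid using fun b => hX o b (1 / 2) (by norm_num)
  refine ⟨fun n => mid^[n] p, rfl, fun n => ?_⟩
  simpa only [Function.iterate_succ_apply'] using hmid _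

namespace IsHalvingSequence

theorem dist_eq (ha : IsHalvingSequence o a) (n : ℕ) :
    dist o (a n) = (1 / 2) ^ n * dist o (a 0) := by
  induction n with
  | zero => rw [pow_zero, one_mul]
  | succ n ih => rw [(ha n).dist_left, ih, pow_succ']; ring

theorem four_pow_mul_dist_sq (ha : IsHalvingSequence o a) (n : ℕ) :
    4 ^ n * dist o (a n) ^ 2 = dist o (a 0) ^ 2 := by
  rw [ha.dist_eq, mul_pow, ← pow_mul, mul_comm n, pow_mul, ← mul_assoc, ← mul_pow]
  norm_num

theorem two_mul_comparisonInner_le (hb : IsHalvingSequence o b) (n : ℕ) (x : X) :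
    2 * comparisonInner o x (b (n + 1)) ≤ comparisonInner o x (b n) := by
  have h := (hb n).comparisonInner_le_mul x
  rw [comparisonInner_comm o _ x, comparisonInner_comm o _ x] at h
  linarith

theorem antitone_four_pow_mul_comparisonInner (ha : IsHalvingSequence o a)
    (hb : IsHalvingSequence o b) :
    Antitone fun n => 4 ^ n * comparisonInner o (a n) (b n) := by
  refine antitone_nat_of_succ_le fun n => ?_
  have hle : 4 * comparisonInner o (a (n + 1)) (b (n + 1)) ≤ comparisonInner o (a n) (b n) := by
    have h := ha.two_mul_comparisonInner_le n (b n)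
    rw [comparisonInner_comm o (b n), comparisonInner_comm o (b n)] at h
    linarith [hb.two_mul_comparisonInner_le n (a (n + 1))]
  rw [pow_succ, mul_assoc]
  gcongr

theorem bddBelow_four_pow_mul_comparisonInner (ha : IsHalvingSequence o a)
    (hb : IsHalvingSequence o b) :
    BddBelow (Set.range fun n => 4 ^ n * comparisonInner o (a n) (b n)) := by
  refine ⟨-(dist o (a 0) * dist o (b 0)), Set.forall_mem_range.2 fun n => ?_⟩
  have hpow : (4 : ℝ) ^ n * ((1 / 2) ^ n * (1 / 2) ^ n) = 1 := by
    rw [← mul_pow, ← mul_pow]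
    norm_num
  calc -(dist o (a 0) * dist o (b 0)) = 4 ^ n * -(dist o (a n) * dist o (b n)) := by
        rw [ha.dist_eq n, hb.dist_eq n]
        linear_combination dist o (a 0) * dist o (b 0) * hpow
    _ ≤ 4 ^ n * comparisonInner o (a n) (b n) := by
        gcongr
        exact neg_dist_mul_dist_le_comparisonInner o _ _

theorem four_pow_mul_normSqExcess_le (ha : IsHalvingSequence o a) (hb : IsHalvingSequence o b)
    {s : ℝ} (hs : s ∈ Set.Icc (0 : ℝ) 1) {n : ℕ} {m : X}
    (hm : IsComparisonPoint s (a (n + 1)) (b (n + 1)) m) :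
    4 ^ (n + 1) * normSqExcess o s (a (n + 1)) (b (n + 1)) m ≤
      4 * s * (4 ^ n * comparisonInner o (a n) (b n) -
        4 ^ (n + 1) * comparisonInner o (a (n + 1)) (b (n + 1))) :=
  calc 4 ^ (n + 1) * normSqExcess o s (a (n + 1)) (b (n + 1)) m
      ≤ 4 ^ (n + 1) * (2 * s * (comparisonInner o (a n) (b (n + 1)) -
          2 * comparisonInner o (a (n + 1)) (b (n + 1)))) := by
        gcongr
        exact hm.normSqExcess_le hs.2 (ha n)
    _ = 4 * s * (4 ^ n * (2 * comparisonInner o (a n) (b (n + 1))) -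
          4 ^ (n + 1) * comparisonInner o (a (n + 1)) (b (n + 1))) := by ring
    _ ≤ _ := by
        have hs0 := hs.1
        gcongr
        exact hb.two_mul_comparisonInner_le n (a n)

theorem exists_four_pow_mul_normSqExcess_le (ha : IsHalvingSequence o a)
    (hb : IsHalvingSequence o b) {s : ℝ} (hs : s ∈ Set.Icc (0 : ℝ) 1) {η : ℝ} (hη : 0 < η) :
    ∃ n, ∀ m, IsComparisonPoint s (a n) (b n) m →
      4 ^ n * normSqExcess o s (a n) (b n) m ≤ η := by
  have hlim := tendsto_atTop_ciInf (ha.antitone_four_pow_mul_comparisonInner hb)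
    (ha.bddBelow_four_pow_mul_comparisonInner hb)
  have hdiff := (hlim.sub (hlim.comp (tendsto_add_atTop_nat 1))).const_mul (4 * s)
  rw [sub_self, mul_zero] at hdiff
  obtain ⟨n, hn⟩ := (hdiff.eventually_le_const hη).exists
  exact ⟨n + 1, fun m hm => (ha.four_pow_mul_normSqExcess_le hb hs hm).trans hn⟩

end IsHalvingSequence

end HalvingSequences

section FormalCombinations

variable {X ι : Type*} [PseudoMetricSpace X] {o p m : X} {c : ℝ} {s : Finset ι} {w : ι → ℝ}
  {x : ι → X}

/-- The squared norm of the formal vector `c p + ∑ i ∈ s, w i x i`, expanded with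
`comparisonInner o`. -/
noncomputable def formalNormSq (o : X) (c : ℝ) (p : X) (s : Finset ι) (w : ι → ℝ) (x : ι → X) :
    ℝ :=
  c ^ 2 * dist o p ^ 2 + 2 * c * ∑ i ∈ s, w i * comparisonInner o p (x i) +
    ∑ i ∈ s, ∑ j ∈ s, w i * w j * comparisonInner o (x i) (x j)

theorem formalNormSq_cons (o : X) (c : ℝ) (p : X) {k : ι} (hk : k ∉ s) (w : ι → ℝ) (x : ι → X) :
    formalNormSq o c p (s.cons k hk) w x =
      formalNormSq o c p s w x + 2 * c * w k * comparisonInner o p (x k) +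
        2 * w k * (∑ i ∈ s, w i * comparisonInner o (x k) (x i)) + w k ^ 2 * dist o (x k) ^ 2 := by
  have hrow : ∑ j ∈ s, w k * w j * comparisonInner o (x k) (x j) =
      w k * ∑ j ∈ s, w j * comparisonInner o (x k) (x j) := by
    simp only [mul_sum, mul_assoc]
  have hcol : ∑ i ∈ s, w i * w k * comparisonInner o (x i) (x k) =
      w k * ∑ i ∈ s, w i * comparisonInner o (x k) (x i) := by
    rw [← hrow]
    simp only [mul_comm (w k), comparisonInner_comm o (x k)]
  simp only [formalNormSq, sum_cons, sum_add_distrib, comparisonInner_self, hrow, hcol]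
  ring

theorem four_pow_mul_formalNormSq_le {P : ℕ → X} {Q : ι → ℕ → X} (hc : 0 ≤ c)
    (hw : ∀ i ∈ s, 0 ≤ w i) (hP : IsHalvingSequence o P) (hQ : ∀ i, IsHalvingSequence o (Q i))
    (n : ℕ) :
    4 ^ n * formalNormSq o c (P n) s w (fun i => Q i n) ≤
      formalNormSq o c (P 0) s w (fun i => Q i 0) := by
  have hinner : ∀ {a b : ℕ → X}, IsHalvingSequence o a → IsHalvingSequence o b →
      4 ^ n * comparisonInner o (a n) (b n) ≤ comparisonInner o (a 0) (b 0) := fun ha hb => by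
    simpa using ha.antitone_four_pow_mul_comparisonInner hb n.zero_le
  calc 4 ^ n * formalNormSq o c (P n) s w (fun i => Q i n)
      = c ^ 2 * dist o (P 0) ^ 2 +
          2 * c * ∑ i ∈ s, w i * (4 ^ n * comparisonInner o (P n) (Q i n)) +
          ∑ i ∈ s, ∑ j ∈ s, w i * w j * (4 ^ n * comparisonInner o (Q i n) (Q j n)) := by
        simp only [formalNormSq, ← hP.four_pow_mul_dist_sq n, mul_left_comm _ ((4 : ℝ) ^ n),
          ← mul_sum]
        ring
    _ ≤ formalNormSq o c (P 0) s w (fun i => Q i 0) := by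
        unfold formalNormSq
        gcongr with i hi i hi j hj
        · exact hw i hi
        · exact hinner hP (hQ i)
        · exact mul_nonneg (hw i hi) (hw j hj)
        · exact hinner (hQ i) (hQ j)

theorem IsComparisonPoint.formalNormSq_le {W r : ℝ} {k : ι} (hk : k ∉ s)
    (hm : IsComparisonPoint r p (x k) m) (hW : 0 ≤ W) (hw : ∀ i ∈ s, 0 ≤ w i)
    (hcW : c = (1 - r) * W) (hkW : w k = r * W) :
    formalNormSq o W m s w x ≤ formalNormSq o c p (s.cons k hk) w x +
      W * (W + ∑ i ∈ s, w i) * normSqExcess o r p (x k) m := by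
  have hsum : ∑ i ∈ s, w i * comparisonInner o m (x i) ≤
      (1 - r) * ∑ i ∈ s, w i * comparisonInner o p (x i) +
        r * ∑ i ∈ s, w i * comparisonInner o (x k) (x i) +
        normSqExcess o r p (x k) m / 2 * ∑ i ∈ s, w i := by
    simp only [mul_sum, ← sum_add_distrib]
    refine sum_le_sum fun i hi => ?_
    linarith [mul_le_mul_of_nonneg_left (hm.comparisonInner_le o (x i)) (hw i hi)]
  have hnorm : dist o m ^ 2 = (1 - r) ^ 2 * dist o p ^ 2 +
      2 * r * (1 - r) * comparisonInner o p (x k) + r ^ 2 * dist o (x k) ^ 2 +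
      normSqExcess o r p (x k) m := by
    rw [normSqExcess]
    ring
  rw [formalNormSq_cons, formalNormSq, formalNormSq, hnorm, hcW, hkW]
  linarith [mul_le_mul_of_nonneg_left hsum (mul_nonneg zero_le_two hW)]

-- The two vectors `c p` and `w k • x k` are merged after rescaling all points by `2 ^ (-n)`.
theorem HasComparisonPoints.exists_four_pow_mul_formalNormSq_le (hX : HasComparisonPoints X)
    (o : X) (hc : 0 ≤ c) (p : X) {k : ι} (hk : k ∉ s) (hw : ∀ i ∈ s.cons k hk, 0 ≤ w i)
    (x : ι → X) {ε : ℝ} (hε : 0 < ε) :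
    ∃ (n : ℕ) (m : X) (y : ι → X), 4 ^ n * formalNormSq o (c + w k) m s w y ≤
      formalNormSq o c p (s.cons k hk) w x + ε := by
  obtain ⟨hwk, hws⟩ := (forall_mem_cons hk _).1 hw
  set W := c + w k
  have hW : 0 ≤ W := add_nonneg hc hwk
  set r := w k / W
  have hr : r ∈ Set.Icc (0 : ℝ) 1 :=
    ⟨div_nonneg hwk hW, div_le_one_of_le₀ (le_add_of_nonneg_left hc) hW⟩
  have hkW : w k = r * W := (div_mul_cancel_of_imp fun h => by linarith).symm
  have hcW : c = (1 - r) * W := by linarith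
  set C := W * (W + ∑ i ∈ s, w i)
  have hC : 0 ≤ C := mul_nonneg hW (add_nonneg hW (sum_nonneg hws))
  obtain ⟨P, hP0, hP⟩ := hX.exists_isHalvingSequence o p
  choose Q hQ0 hQ using fun i => hX.exists_isHalvingSequence o (x i)
  obtain ⟨n, hn⟩ := hP.exists_four_pow_mul_normSqExcess_le (hQ k) hr
    (div_pos hε (add_pos_of_nonneg_of_pos hC one_pos))
  obtain ⟨m, hm⟩ := hX (P n) (Q k n) r hr
  refine ⟨n, m, fun i => Q i n, ?_⟩
  calc 4 ^ n * formalNormSq o W m s w (fun i => Q i n)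
      ≤ 4 ^ n * (formalNormSq o c (P n) (s.cons k hk) w (fun i => Q i n) +
          C * normSqExcess o r (P n) (Q k n) m) := by
        gcongr
        exact hm.formalNormSq_le (x := fun i => Q i n) hk hW hws hcW hkW
    _ = 4 ^ n * formalNormSq o c (P n) (s.cons k hk) w (fun i => Q i n) +
          C * (4 ^ n * normSqExcess o r (P n) (Q k n) m) := by ring
    _ ≤ formalNormSq o c p (s.cons k hk) w x + C * (ε / (C + 1)) := by
        gcongr
        · simpa only [hP0, hQ0] using four_pow_mul_formalNormSq_le hc hw hP hQ n
        · exact hn m hm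
    _ ≤ formalNormSq o c p (s.cons k hk) w x + ε := by
        gcongr
        rw [mul_div_left_comm]
        exact mul_le_of_le_one_right hε.le (div_le_one_of_le₀ (by linarith) (by linarith))

theorem HasComparisonPoints.formalNormSq_nonneg (hX : HasComparisonPoints X) (o : X) (hc : 0 ≤ c)
    (p : X) (hw : ∀ i ∈ s, 0 ≤ w i) (x : ι → X) : 0 ≤ formalNormSq o c p s w x := by
  induction s using Finset.cons_induction generalizing c p x with
  | empty =>
    simp only [formalNormSq, sum_empty, mul_zero, add_zero]
    positivity
  | cons k s hk ih =>
    refine le_of_forall_pos_le_add fun ε hε => ?_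
    obtain ⟨n, m, y, hle⟩ := hX.exists_four_pow_mul_formalNormSq_le o hc p hk hw x hε
    obtain ⟨hwk, hws⟩ := (forall_mem_cons hk _).1 hw
    exact (mul_nonneg (by positivity) (ih (add_nonneg hc hwk) m hws y)).trans hle

theorem HasComparisonPoints.sum_sum_mul_dist_sq_le (hX : HasComparisonPoints X) (y : X)
    (hw : ∀ i ∈ s, 0 ≤ w i) (x : ι → X) :
    ∑ i ∈ s, ∑ j ∈ s, w i * w j * dist (x i) (x j) ^ 2 ≤
      2 * (∑ i ∈ s, w i) * ∑ i ∈ s, w i * dist y (x i) ^ 2 := by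
  have h := hX.formalNormSq_nonneg y le_rfl y hw x
  have hswap : ∑ i ∈ s, ∑ j ∈ s, w i * w j * dist y (x i) ^ 2 =
      ∑ i ∈ s, ∑ j ∈ s, w i * w j * dist y (x j) ^ 2 := by
    rw [sum_comm]
    simp only [mul_comm (w _) (w _)]
  have hprod : ∑ i ∈ s, ∑ j ∈ s, w i * w j * dist y (x j) ^ 2 =
      (∑ i ∈ s, w i) * ∑ i ∈ s, w i * dist y (x i) ^ 2 := by
    simp only [sum_mul_sum, mul_assoc]
  simp only [formalNormSq, comparisonInner, mul_div_assoc', ← sum_div, mul_sub, mul_add,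
    sum_sub_distrib, sum_add_distrib, hswap, hprod] at h
  linarith

end FormalCombinations

section Chains

theorem sqrt_add_mul_sqrt_le {a b : ℝ} (hb : 0 ≤ b) (hab : b ≤ a) :
    √a + (1 + √2) * √b ≤ (1 + √2) * √(a + b) := by
  have ha : 0 ≤ a := hb.trans hab
  have hsqrt : √a * √b ≤ a := by
    simpa only [Real.mul_self_sqrt ha] using
      mul_le_mul_of_nonneg_left (Real.sqrt_le_sqrt hab) (Real.sqrt_nonneg a)
  have hc : (1 + √2) ^ 2 = 1 + 2 * (1 + √2) := by
    linear_combination Real.sq_sqrt (zero_le_two (α := ℝ))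
  refine le_of_sq_le_sq ?_ (by positivity)
  calc (√a + (1 + √2) * √b) ^ 2
      = a + 2 * (1 + √2) * (√a * √b) + (1 + √2) ^ 2 * b := by
        linear_combination Real.sq_sqrt ha + (1 + √2) ^ 2 * Real.sq_sqrt hb
    _ ≤ a + 2 * (1 + √2) * a + (1 + √2) ^ 2 * b := by gcongr
    _ = ((1 + √2) * √(a + b)) ^ 2 := by
        rw [mul_pow, Real.sq_sqrt (add_nonneg ha hb)]
        linear_combination -a * hc

theorem sqrt_sum_mul_add_sq_le {ι : Type*} [Fintype ι] {p : ι → ℝ} (hp : ∀ i, 0 ≤ p i)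
    (f g : ι → ℝ) :
    √(∑ i, p i * (f i + g i) ^ 2) ≤ √(∑ i, p i * f i ^ 2) + √(∑ i, p i * g i ^ 2) := by
  have hnorm : ∀ h : ι → ℝ, √(∑ i, p i * h i ^ 2) = ‖WithLp.toLp 2 fun i => √(p i) * h i‖ := by
    intro h
    simp only [EuclideanSpace.norm_eq, Real.norm_eq_abs, sq_abs, mul_pow, Real.sq_sqrt (hp _)]
  simp only [hnorm, mul_add]
  exact norm_add_le (WithLp.toLp 2 fun i => √(p i) * f i) (WithLp.toLp 2 fun i => √(p i) * g i)

variable {X : Type*} [PseudoMetricSpace X] {N : ℕ} {π : Fin N → ℝ}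
  {A B : Matrix (Fin N) (Fin N) ℝ}

/-- The mean squared distance covered by one step of the chain with initial distribution `π` and
transition matrix `A`, where state `i` is located at `x i`. -/
noncomputable def energy (x : Fin N → X) (π : Fin N → ℝ) (A : Matrix (Fin N) (Fin N) ℝ) : ℝ :=
  ∑ i, ∑ j, π i * A i j * dist (x i) (x j) ^ 2

theorem energy_nonneg (x : Fin N → X) (hπ : ∀ i, 0 ≤ π i) (hA : ∀ i j, 0 ≤ A i j) :
    0 ≤ energy x π A :=
  sum_nonneg fun i _ => sum_nonneg fun j _ => mul_nonneg (mul_nonneg (hπ i) (hA i j)) (sq_nonneg _)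

namespace IsReversibleChain

theorem mem_rowStochastic (h : IsReversibleChain π A) : A ∈ Matrix.rowStochastic ℝ (Fin N) :=
  Matrix.mem_rowStochastic_iff_sum.2 ⟨h.trans_nonneg, h.trans_sum⟩

theorem semiconjBy (h : IsReversibleChain π A) :
    SemiconjBy (Matrix.diagonal π) A A.transpose := by
  ext i j
  rw [Matrix.diagonal_mul, Matrix.mul_diagonal, Matrix.transpose_apply, h.reversible, mul_comm]

protected theorem pow (h : IsReversibleChain π A) (l : ℕ) : IsReversibleChain π (A ^ l) where
  init_nonneg := h.init_nonneg
  init_le_one := h.init_le_one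
  init_sum := h.init_sum
  trans_nonneg _ _ := Matrix.nonneg_of_mem_rowStochastic (pow_mem h.mem_rowStochastic l)
  trans_le_one _ _ := Matrix.le_one_of_mem_rowStochastic (pow_mem h.mem_rowStochastic l)
  trans_sum := Matrix.sum_row_of_mem_rowStochastic (pow_mem h.mem_rowStochastic l)
  reversible i j := by
    have hij := congrFun₂ (h.semiconjBy.pow_right l).eq i j
    rwa [← Matrix.transpose_pow, Matrix.diagonal_mul, Matrix.mul_diagonal,
      Matrix.transpose_apply, mul_comm _ (π j)] at hij

-- A step of `A` followed by one of `B` leads from one end to the other of a pair of independent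
-- steps with a common origin.
theorem energy_mul (h : IsReversibleChain π A) (x : Fin N → X) (B : Matrix (Fin N) (Fin N) ℝ) :
    energy x π (A * B) = ∑ k, ∑ i, ∑ j, π k * A k i * B k j * dist (x i) (x j) ^ 2 := by
  calc energy x π (A * B)
      = ∑ i, ∑ j, ∑ k, π k * A k i * B k j * dist (x i) (x j) ^ 2 := by
        simp only [energy, Matrix.mul_apply, mul_sum, sum_mul, ← mul_assoc, h.reversible]
    _ = _ := sum_comm_cycle

theorem energy_mul_self_le (hX : HasComparisonPoints X) (h : IsReversibleChain π A)
    (x : Fin N → X) : energy x π (A * A) ≤ 2 * energy x π A :=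
  calc energy x π (A * A)
      = ∑ k, π k * ∑ i, ∑ j, A k i * A k j * dist (x i) (x j) ^ 2 := by
        simp only [h.energy_mul, mul_sum, mul_assoc]
    _ ≤ ∑ k, π k * (2 * (∑ i, A k i) * ∑ i, A k i * dist (x k) (x i) ^ 2) := by
        gcongr with k
        · exact h.init_nonneg k
        · exact hX.sum_sum_mul_dist_sq_le (x k) (fun i _ => h.trans_nonneg k i) x
    _ = 2 * energy x π A := by
        simp only [h.trans_sum, energy, mul_sum, mul_one, mul_assoc, mul_left_comm _ (2 : ℝ)]

theorem sqrt_energy_mul_le (hA : IsReversibleChain π A) (hB : B ∈ Matrix.rowStochastic ℝ (Fin N))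
    (x : Fin N → X) : √(energy x π (A * B)) ≤ √(energy x π A) + √(energy x π B) := by
  have hp : ∀ t : Fin N × Fin N × Fin N, 0 ≤ π t.1 * A t.1 t.2.1 * B t.1 t.2.2 := fun t =>
    mul_nonneg (mul_nonneg (hA.init_nonneg _) (hA.trans_nonneg _ _))
      (Matrix.nonneg_of_mem_rowStochastic hB)
  have hEA : energy x π A =
      ∑ t : Fin N × Fin N × Fin N, π t.1 * A t.1 t.2.1 * B t.1 t.2.2 *
        dist (x t.1) (x t.2.1) ^ 2 := by
    simp only [Fintype.sum_prod_type, energy, mul_right_comm _ (B _ _), ← mul_sum,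
      Matrix.sum_row_of_mem_rowStochastic hB, mul_one]
  have hEB : energy x π B =
      ∑ t : Fin N × Fin N × Fin N, π t.1 * A t.1 t.2.1 * B t.1 t.2.2 *
        dist (x t.1) (x t.2.2) ^ 2 := by
    simp only [Fintype.sum_prod_type]
    refine sum_congr rfl fun k _ => ?_
    rw [sum_comm]
    simp only [← sum_mul, ← mul_sum, hA.trans_sum, mul_one]
  rw [hA.energy_mul, hEA, hEB]
  refine le_trans ?_ (sqrt_sum_mul_add_sq_le hp _ _)
  simp only [Fintype.sum_prod_type]
  gcongr with k _ i _ j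
  · exact hp (k, i, j)
  · exact dist_triangle_left _ _ _

theorem energy_pow_two_pow_le (hX : HasComparisonPoints X) (h : IsReversibleChain π A)
    (x : Fin N → X) (n : ℕ) : energy x π (A ^ 2 ^ n) ≤ 2 ^ n * energy x π A := by
  induction n with
  | zero => simp only [pow_zero, pow_one, one_mul, le_refl]
  | succ n ih =>
    calc energy x π (A ^ 2 ^ (n + 1)) = energy x π (A ^ 2 ^ n * A ^ 2 ^ n) := by
          rw [← pow_add, ← two_mul, ← pow_succ']
      _ ≤ 2 * energy x π (A ^ 2 ^ n) := (h.pow _).energy_mul_self_le hX x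
      _ ≤ 2 * (2 ^ n * energy x π A) := by gcongr
      _ = 2 ^ (n + 1) * energy x π A := by ring

theorem sqrt_energy_pow_le (hX : HasComparisonPoints X) (h : IsReversibleChain π A)
    (x : Fin N → X) (l : ℕ) : √(energy x π (A ^ l)) ≤ (1 + √2) * √l * √(energy x π A) := by
  induction l using Nat.strong_induction_on with
  | _ l ih =>
    rcases l.eq_zero_or_pos with rfl | hl
    · simp [energy, Matrix.one_apply]
    obtain ⟨m, hm⟩ := Nat.exists_eq_add_of_le (Nat.pow_log_le_self 2 hl.ne')
    have hlt := Nat.lt_pow_succ_log_self one_lt_two l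
    set n := Nat.log 2 l
    have hmn : m < 2 ^ n := by
      rw [pow_succ] at hlt
      omega
    have hlt_l : m < l := hm ▸ Nat.lt_add_of_pos_left (by positivity)
    calc √(energy x π (A ^ l)) = √(energy x π (A ^ 2 ^ n * A ^ m)) := by rw [← pow_add, ← hm]
      _ ≤ √(energy x π (A ^ 2 ^ n)) + √(energy x π (A ^ m)) :=
        (h.pow _).sqrt_energy_mul_le (pow_mem h.mem_rowStochastic m) x
      _ ≤ √(2 ^ n) * √(energy x π A) + (1 + √2) * √m * √(energy x π A) := by
        gcongr
        · rw [← Real.sqrt_mul (by positivity)]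
          exact Real.sqrt_le_sqrt (h.energy_pow_two_pow_le hX x n)
        · exact ih m hlt_l
      _ = (√(2 ^ n) + (1 + √2) * √m) * √(energy x π A) := by ring
      _ ≤ (1 + √2) * √(2 ^ n + m) * √(energy x π A) := by
        gcongr
        exact sqrt_add_mul_sqrt_le m.cast_nonneg (mod_cast hmn.le)
      _ = (1 + √2) * √l * √(energy x π A) := by
        rw [hm]
        push_cast
        rfl

theorem energy_pow_le (hX : HasComparisonPoints X) (h : IsReversibleChain π A) (x : Fin N → X)
    (l : ℕ) : energy x π (A ^ l) ≤ (1 + √2) ^ 2 * l * energy x π A := by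
  have hE : 0 ≤ energy x π A := energy_nonneg x h.init_nonneg h.trans_nonneg
  have hle := (Real.sqrt_le_left (by positivity)).1 (h.sqrt_energy_pow_le hX x l)
  rwa [mul_pow, mul_pow, Real.sq_sqrt l.cast_nonneg, Real.sq_sqrt hE] at hle

end IsReversibleChain

end Chains

section Resolvent

variable {N : ℕ} {A : Matrix (Fin N) (Fin N) ℝ} {α : ℝ}

section LinftyOpNorm

attribute [local instance] Matrix.linftyOpNormedRing Matrix.linftyOpNormedAlgebra

theorem norm_le_one_of_mem_rowStochastic {ι : Type*} [Fintype ι] [DecidableEq ι]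
    {A : Matrix ι ι ℝ} (hA : A ∈ Matrix.rowStochastic ℝ ι) : ‖A‖ ≤ 1 := by
  rw [Matrix.linfty_opNorm_def]
  refine NNReal.coe_le_one.2 (Finset.sup_le fun i _ => ?_)
  rw [← NNReal.coe_le_coe]
  simp only [NNReal.coe_sum, coe_nnnorm, NNReal.coe_one, le_refl,
    Real.norm_of_nonneg (Matrix.nonneg_of_mem_rowStochastic hA),
    Matrix.sum_row_of_mem_rowStochastic hA]

theorem hasSum_resolventMatrix (hA : A ∈ Matrix.rowStochastic ℝ (Fin N)) (hα : |α| < 1)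
    (i j : Fin N) :
    HasSum (fun l : ℕ => (1 - α) * α ^ l * (A ^ l) i j) (resolventMatrix α A i j) := by
  have hnorm : ‖α • A‖ < 1 := by
    rw [norm_smul, Real.norm_eq_abs]
    exact (mul_le_of_le_one_right (abs_nonneg α) (norm_le_one_of_mem_rowStochastic hA)).trans_lt hα
  have hsum : HasSum (fun l : ℕ => (α • A) ^ l) (1 - α • A)⁻¹ := by
    rw [Matrix.inv_eq_right_inv (mul_neg_geom_series _ hnorm)]
    exact (summable_geometric_of_norm_lt_one hnorm).hasSum
  have hij := (Pi.hasSum.1 (Pi.hasSum.1 hsum i) j).mul_left (1 - α)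
  simp only [smul_pow, Matrix.smul_apply, smul_eq_mul, ← mul_assoc] at hij
  exact hij

end LinftyOpNorm

theorem hasSum_energy_resolventMatrix {X : Type*} [PseudoMetricSpace X]
    (hA : A ∈ Matrix.rowStochastic ℝ (Fin N)) (hα : |α| < 1) (x : Fin N → X) (π : Fin N → ℝ) :
    HasSum (fun l : ℕ => (1 - α) * α ^ l * energy x π (A ^ l))
      (energy x π (resolventMatrix α A)) := by
  have hsum := hasSum_sum fun i (_ : i ∈ univ) => hasSum_sum fun j (_ : j ∈ univ) =>
    ((hasSum_resolventMatrix hA hα i j).mul_left (π i)).mul_right (dist (x i) (x j) ^ 2)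
  simpa only [energy, mul_sum, mul_assoc, mul_left_comm (π _)] using hsum

theorem markovTypeTwoWith_of_energy_pow_le {X : Type*} [MetricSpace X] {K : ℝ}
    (hK : ∀ (l N : ℕ) (x : Fin N → X) (π : Fin N → ℝ) (A : Matrix (Fin N) (Fin N) ℝ),
      IsReversibleChain π A → energy x π (A ^ l) ≤ K ^ 2 * l * energy x π A) :
    MarkovTypeTwoWith X K := by
  intro α h0 h1 N x π A h
  have hα : |α| < 1 := by rwa [abs_of_pos h0]
  have h1' : 0 < 1 - α := sub_pos.2 h1
  have hmean : HasSum (fun l : ℕ => (1 - α) * α ^ l * (K ^ 2 * l * energy x π A))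
      ((1 - α) * (K ^ 2 * energy x π A) * (α / (1 - α) ^ 2)) := by
    have hterm : ∀ l : ℕ, (1 - α) * (K ^ 2 * energy x π A) * (l * α ^ l) =
        (1 - α) * α ^ l * (K ^ 2 * l * energy x π A) := fun l => by ring
    simp only [← hterm]
    exact (hasSum_coe_mul_geometric_of_norm_lt_one (r := α) hα).mul_left _
  calc (1 - α) * energy x π (resolventMatrix α A)
      ≤ (1 - α) * ((1 - α) * (K ^ 2 * energy x π A) * (α / (1 - α) ^ 2)) := by
        gcongr
        refine hasSum_le (fun l => ?_) (hasSum_energy_resolventMatrix h.mem_rowStochastic hα x π)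
          hmean
        gcongr
        exact hK l N x π A h
    _ = K ^ 2 * α * energy x π A := by
        field_simp

end Resolvent

end MarkovTypeTwo

theorem theorem4p2 {X : Type*} [MetricSpace X] (hX : MarkovTypeTwo.IsAlexandrovNonneg X) :
    MarkovTypeTwo.HasMarkovTypeTwo X ∧
    MarkovTypeTwo.markovConst X ≤ 1 + Real.sqrt 2 ∧
    ∀ (l : ℕ), 1 ≤ l → ∀ (N : ℕ) (x : Fin N → X) (π : Fin N → ℝ)
      (A : Matrix (Fin N) (Fin N) ℝ), MarkovTypeTwo.IsReversibleChain π A →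
        ∑ i, ∑ j, π i * (A ^ l) i j * dist (x i) (x j) ^ 2 ≤
          (1 + Real.sqrt 2) ^ 2 * l * ∑ i, ∑ j, π i * A i j * dist (x i) (x j) ^ 2 := by
  have hK : 1 ≤ 1 + Real.sqrt 2 := le_add_of_nonneg_right (Real.sqrt_nonneg 2)
  have hE := fun (l N : ℕ) (x : Fin N → X) (π : Fin N → ℝ) (A : Matrix (Fin N) (Fin N) ℝ)
    (h : MarkovTypeTwo.IsReversibleChain π A) => h.energy_pow_le hX.hasComparisonPoints x l
  have hM := MarkovTypeTwo.markovTypeTwoWith_of_energy_pow_le hE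
  exact ⟨⟨_, hK, hM⟩, csInf_le ⟨1, fun _ h => h.1⟩ ⟨hK, hM⟩, fun l _ => hE l⟩
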